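/- Let $n \geq 2$, let $S^{n-1} = \{\theta \in \mathbf{R}^n : |\theta| = 1\}$ be the Euclidean unit sphere and let $\sigma_{n-1}$ be the uniform (normalized surface) probability measure on $S^{n-1}$. Let $f$ be a real-valued function which is defined and $C^2$-smooth in some open neighbourhood $G$ of $S^{n-1}$ in $\mathbf{R}^n$, and let $f''(x) = (\partial_{ij} f(x))_{i,j=1}^n$ denote its matrix of second order Euclidean partial derivatives. If $f$ is orthogonal in $L^2(S^{n-1},\sigma_{n-1})$ to all affine functions, that is, $\int f(\theta)\,(c + \langle v,\theta\rangle)\,d\sigma_{n-1}(\theta) = 0$ for all $c \in \mathbf{R}$ and $v \in \mathbf{R}^n$, then for every $a \in \mathbf{R}$, $$ \int f^2\,d\sigma_{n-1} \leq \frac{5}{(n-1)^2} \int \|f'' - a I_n\|_{\rm HS}^2\,d\sigma_{n-1}, $$ where $I_n$ is the $n \times n$ identity matrix and $\|A\|_{\rm HS} = \big(\sum_{i,j} A_{ij}^2\big)^{1/2}$ is the Hilbert-Schmidt norm. -/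

import Mathlib

open MeasureTheory

attribute [local instance] Matrix.frobeniusNormedAddCommGroup

/-- The uniform probability measure `σ_{n-1}` on the unit sphere `S^{n-1}` of `ℝⁿ`: the surface
measure, normalized to have total mass one. -/
noncomputable def sphereUniform (n : ℕ) :
    Measure (Metric.sphere (0 : EuclideanSpace ℝ (Fin n)) 1) :=
  ((volume : Measure (EuclideanSpace ℝ (Fin n))).toSphere Set.univ)⁻¹ •
    (volume : Measure (EuclideanSpace ℝ (Fin n))).toSphere

/-- The partial derivative `∂ᵢ f` of a function on `ℝⁿ`. -/
noncomputable def partialDeriv {n : ℕ} (i : Fin n) (f : EuclideanSpace ℝ (Fin n) → ℝ) :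
    EuclideanSpace ℝ (Fin n) → ℝ :=
  fun x => fderiv ℝ f x (EuclideanSpace.single i 1)

/-- The Euclidean second derivative `f''(x) = (∂ᵢⱼ f(x))ᵢⱼ`, the matrix of second order partial
derivatives. -/
noncomputable def hessianMatrix {n : ℕ} (f : EuclideanSpace ℝ (Fin n) → ℝ)
    (x : EuclideanSpace ℝ (Fin n)) : Matrix (Fin n) (Fin n) ℝ :=
  Matrix.of fun i j => partialDeriv i (partialDeriv j f) x

/-- `f` is orthogonal in `L²(S^{n-1}, σ_{n-1})` to the restrictions to the sphere of all affine
functions on `ℝⁿ`. -/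
def OrthogonalToAffine {n : ℕ} (f : EuclideanSpace ℝ (Fin n) → ℝ) : Prop :=
  ∀ l : EuclideanSpace ℝ (Fin n) →ᵃ[ℝ] ℝ, ∫ θ, f θ * l θ ∂(sphereUniform n) = 0

/-!
# A second order Poincaré inequality on the sphere

The inequality is the spherical Poincaré inequality `(n - 1) Var g ≤ 2 ∫ ‖∇g‖²`
(`sphere_poincare_centered`) applied twice; the constant obtained is `2 * 2 = 4 ≤ 5`. Let
`v = ∇f - a x` be the gradient of `f - a ‖x‖² / 2`, and let `m` be its mean over the sphere. The
derivative of `v` is `f'' - a I`, so the Poincaré inequality for the components of `v` gives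
`(n - 1) ∫ ‖v - m‖² ≤ 2 ∫ ‖f'' - a I‖²`. Now `v - m` is the gradient of
`h = f - a ‖x‖² / 2 - ⟨m, x⟩`, and on the sphere `h` minus its mean is `f - l` with `l` affine. As `f`
is orthogonal to `l`, it follows that `∫ f² ≤ ∫ (f - l)² = Var h ≤ 2 / (n - 1) ∫ ‖v - m‖²`.

The spherical Poincaré inequality is deduced from a Gaussian one. For independent standard Gaussian
vectors `X`, `Y`, integrating along the arc `cos t • X + sin t • Y`, `0 ≤ t ≤ π / 2`, and using that the
law of `(X, Y)` is invariant under rotations in `E × E`, one finds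
`Var G(X) ≤ π² / 8 * 𝔼 ‖∇G(X)‖²` (`variance_stdGaussian_le`). It is applied to the extension
`G(x) = ‖x‖ g(x / ‖x‖)` of a mean-zero function `g` on the sphere. The norm and the direction of `X` are
independent (`integral_stdGaussian_norm_mul_direction`), so `𝔼 G(X)² = n ∫ g²`, while
`‖∇G(x)‖² ≤ g² + ‖∇g‖²` at `x / ‖x‖`. Hence `(n - π² / 8) ∫ g² ≤ π² / 8 ∫ ‖∇g‖²`, which suffices
because `π² / 8 ≤ 5 / 4`. The homogeneity of degree one matters here: with the extension of degree
zero the left-hand side would carry `n - 2`, useless for the circle.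
-/

open ProbabilityTheory Metric Set

/-! ### Polar decomposition of the standard Gaussian measure -/

section Polar

variable {E : Type*} [NormedAddCommGroup E] [InnerProductSpace ℝ E] [FiniteDimensional ℝ E]
  [MeasurableSpace E] [BorelSpace E]

/-- The density of the standard Gaussian measure. Both sides have the same characteristic function. The
normalizing constant is left as an integral. -/
theorem stdGaussian_eq_withDensity :
    stdGaussian E = (volume : Measure E).withDensity fun x ↦
      ENNReal.ofReal ((∫ y : E, Real.exp (-(1 / 2) * ‖y‖ ^ 2))⁻¹ * Real.exp (-(1 / 2) * ‖x‖ ^ 2)) := by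
  set c : ℝ := ∫ y : E, Real.exp (-(1 / 2) * ‖y‖ ^ 2) with hc
  have hcval : c = (Real.pi / (1 / 2)) ^ (Module.finrank ℝ E / 2 : ℝ) :=
    GaussianFourier.integral_rexp_neg_mul_sq_norm (V := E) (b := 1 / 2) (by norm_num)
  have hc0 : 0 < c := by rw [hcval]; positivity
  have hint : Integrable (fun x : E ↦ Real.exp (-(1 / 2) * ‖x‖ ^ 2)) := by
    by_contra h
    exact hc0.ne' (hc.trans (integral_undef h))
  have hfin : IsFiniteMeasure ((volume : Measure E).withDensity fun x ↦
      ENNReal.ofReal (c⁻¹ * Real.exp (-(1 / 2) * ‖x‖ ^ 2))) :=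
    isFiniteMeasure_withDensity_ofReal (hint.const_mul _).2
  apply Measure.ext_of_charFun
  ext t
  rw [charFun_stdGaussian, charFun_apply, integral_withDensity_eq_integral_toReal_smul (by fun_prop)
    (by simp)]
  have hF := GaussianFourier.integral_cexp_neg_mul_sq_norm_add (V := E) (b := 1 / 2) (by norm_num)
    Complex.I t
  have h0 := GaussianFourier.integral_cexp_neg_mul_sq_norm (V := E) (b := 1 / 2) (by norm_num)
  have hcC : (c : ℂ) = (Real.pi / (1 / 2) : ℂ) ^ (Module.finrank ℝ E / 2 : ℂ) := by
    rw [← h0, hc, ← integral_complex_ofReal]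
    simp
  rw [← hcC] at hF
  calc Complex.exp (-‖t‖ ^ 2 / 2)
      = (c : ℂ)⁻¹ * (c * Complex.exp (Complex.I ^ 2 * ‖t‖ ^ 2 / (4 * (1 / 2)))) := by
        rw [inv_mul_cancel_left₀ (by exact_mod_cast hc0.ne')]
        congr 1
        simp
        ring
    _ = _ := by
        rw [← hF, ← integral_const_mul]
        congr 1 with x
        rw [ENNReal.toReal_ofReal (by positivity), Complex.exp_add, real_inner_comm,
          Complex.real_smul]
        push_cast
        ring_nf

/-- The norm and the direction of a standard Gaussian vector are independent, and the direction is
uniformly distributed on the sphere. -/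
theorem integral_stdGaussian_norm_mul_direction [Nontrivial E] {k : ℝ → ℝ} {φ : E → ℝ} :
    ∫ x, k ‖x‖ * φ (‖x‖⁻¹ • x) ∂(stdGaussian E) =
      (∫ x, k ‖x‖ ∂(stdGaussian E)) *
        (((volume : Measure E).toSphere.real univ)⁻¹ *
          ∫ θ : sphere (0 : E) 1, φ θ ∂(volume : Measure E).toSphere) := by
  set ρ : ℝ → ℝ := fun r ↦
    (∫ y : E, Real.exp (-(1 / 2) * ‖y‖ ^ 2))⁻¹ * Real.exp (-(1 / 2) * r ^ 2) with hρ
  have hρ0 : ∀ r, 0 ≤ ρ r := fun r ↦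
    mul_nonneg (inv_nonneg.2 (integral_nonneg fun _ ↦ (Real.exp_pos _).le)) (Real.exp_pos _).le
  have key : ∀ ψ : E → ℝ, ∫ x, k ‖x‖ * ψ (‖x‖⁻¹ • x) ∂(stdGaussian E) =
      (∫ θ : sphere (0 : E) 1, ψ θ ∂(volume : Measure E).toSphere) *
        ∫ r : Ioi (0 : ℝ), ρ r * k r ∂(Measure.volumeIoiPow (Module.finrank ℝ E - 1)) := by
    intro ψ
    rw [stdGaussian_eq_withDensity, integral_withDensity_eq_integral_toReal_smul (by fun_prop)
      (by simp), ← integral_prod_mul]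
    calc _ = ∫ x : E, ρ ‖x‖ * (k ‖x‖ * ψ (‖x‖⁻¹ • x)) := by
          congr 1 with x
          rw [ENNReal.toReal_ofReal (hρ0 _), smul_eq_mul]
      _ = ∫ x : ({0}ᶜ : Set E), ρ ‖x.1‖ * (k ‖x.1‖ * ψ (‖x.1‖⁻¹ • x.1))
            ∂((volume : Measure E).comap (↑)) := by
          rw [integral_subtype_comap (measurableSet_singleton _).compl
            fun x : E ↦ ρ ‖x‖ * (k ‖x‖ * ψ (‖x‖⁻¹ • x)), restrict_compl_singleton]
      _ = _ := by
          rw [← (volume : Measure E).measurePreserving_homeomorphUnitSphereProd.integral_comp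
            (Homeomorph.measurableEmbedding _)]
          congr 1 with x
          simp
          ring
  -- The case `ψ = 1` evaluates the radial factor, whatever the normalizing constant of the density.
  have h1 := key fun _ ↦ 1
  simp only [mul_one, integral_const, smul_eq_mul] at h1
  have hpos : (volume : Measure E).toSphere.real univ ≠ 0 := by
    simp [measureReal_eq_zero_iff, Measure.toSphere_ne_zero, -Measure.toSphere_real_apply_univ, -Measure.toSphere_apply_univ]
  rw [key φ, h1]
  field_simp

theorem integral_clm_sq_stdGaussian (L : StrongDual ℝ E) :
    ∫ x, L x ^ 2 ∂(stdGaussian E) = ‖L‖ ^ 2 := by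
  rw [← variance_dual_stdGaussian, variance_of_integral_eq_zero (by fun_prop)
    (integral_strongDual_stdGaussian L)]

theorem integral_stdGaussian_norm_sq :
    ∫ x, ‖x‖ ^ 2 ∂(stdGaussian E) = Module.finrank ℝ E := by
  have h : ∀ x : E, ‖x‖ ^ 2 = ∑ i, (innerSL ℝ (stdOrthonormalBasis ℝ E i) x) ^ 2 := fun x ↦ by
    rw [← (stdOrthonormalBasis ℝ E).sum_sq_inner_right x]
    simp
  simp_rw [h]
  rw [integral_finsetSum]
  · simp_rw [integral_clm_sq_stdGaussian]
    simp
  · intro i _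
    exact (IsGaussian.memLp_dual (stdGaussian E) (innerSL ℝ (stdOrthonormalBasis ℝ E i)) 2
      (by simp)).integrable_sq

end Polar

/-! ### A Gaussian Poincaré inequality -/

section GaussianPoincare

theorem sq_integral_le_mul_integral_sq {φ : ℝ → ℝ} {b : ℝ} (hb : 0 < b) (hφ : Continuous φ) :
    (∫ t in 0..b, φ t) ^ 2 ≤ b * ∫ t in 0..b, φ t ^ 2 := by
  -- The variance of `φ` on `[0, b]` is nonnegative.
  set m := (∫ t in 0..b, φ t) / b with hm
  have h0 : 0 ≤ ∫ t in 0..b, (φ t - m) ^ 2 :=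
    intervalIntegral.integral_nonneg hb.le fun t _ ↦ sq_nonneg _
  have h1 : ∫ t in 0..b, (φ t - m) ^ 2 =
      (∫ t in 0..b, φ t ^ 2) - 2 * m * (∫ t in 0..b, φ t) + b * m ^ 2 := by
    have : ∀ t, (φ t - m) ^ 2 = φ t ^ 2 - 2 * m * φ t + m ^ 2 := fun t ↦ by ring
    simp_rw [this]
    rw [intervalIntegral.integral_add, intervalIntegral.integral_sub,
      intervalIntegral.integral_const_mul, intervalIntegral.integral_const]
    · simp
    all_goals exact Continuous.intervalIntegrable (by fun_prop) _ _
  have h2 : ∫ t in 0..b, φ t = b * m := by rw [hm]; field_simp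
  rw [h1, h2] at h0
  rw [h2]
  nlinarith

variable {E : Type*} [NormedAddCommGroup E] [InnerProductSpace ℝ E]

/-- The function `G` need not be differentiable at the origin: the arc from `p.1` to `p.2` avoids it
because these two vectors are linearly independent. The components of `rotation t p` are the point
`cos t • p.1 + sin t • p.2` of the arc and its velocity. -/
theorem sq_sub_le_integral_sq_fderiv_rotation {G : E → ℝ} (hG : ∀ x ≠ 0, ContDiffAt ℝ 1 G x)
    {p : E × E} (hp : LinearIndependent ℝ ![p.1, p.2]) :
    (G p.2 - G p.1) ^ 2 ≤ Real.pi / 2 * ∫ t in 0..(Real.pi / 2),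
      (fderiv ℝ G (ContinuousLinearMap.rotation t p).1
        (ContinuousLinearMap.rotation t p).2) ^ 2 := by
  obtain ⟨x, y⟩ := p
  simp only [ContinuousLinearMap.rotation_apply] at hp ⊢
  have hz : ∀ t : ℝ, Real.cos t • x + Real.sin t • y ≠ 0 := fun t h ↦ by
    have := LinearIndependent.pair_iff.1 hp _ _ h
    have h1 := Real.cos_sq_add_sin_sq t
    rw [this.1, this.2] at h1
    norm_num at h1
  set φ : ℝ → ℝ := fun t ↦ fderiv ℝ G (Real.cos t • x + Real.sin t • y)
    (-Real.sin t • x + Real.cos t • y) with hφ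
  have hφc : Continuous φ := by
    have h1 : Continuous fun t : ℝ ↦ fderiv ℝ G (Real.cos t • x + Real.sin t • y) := by
      rw [continuous_iff_continuousAt]
      intro t
      exact ContinuousAt.comp (f := fun t : ℝ ↦ Real.cos t • x + Real.sin t • y)
        ((hG _ (hz t)).continuousAt_fderiv one_ne_zero) (by fun_prop)
    exact h1.clm_apply (by fun_prop)
  have hd : ∀ t, HasDerivAt (fun t : ℝ ↦ G (Real.cos t • x + Real.sin t • y)) (φ t) t := fun t ↦
    ((hG _ (hz t)).differentiableAt one_ne_zero).hasFDerivAt.comp_hasDerivAt t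
      (((Real.hasDerivAt_cos t).smul_const x).add ((Real.hasDerivAt_sin t).smul_const y))
  have hftc := intervalIntegral.integral_eq_sub_of_hasDerivAt (a := 0) (b := Real.pi / 2)
    (fun t _ ↦ hd t) (hφc.intervalIntegrable _ _)
  simp only [Real.cos_pi_div_two, Real.sin_pi_div_two, Real.cos_zero, Real.sin_zero, zero_smul,
    one_smul, zero_add, add_zero] at hftc
  rw [← hftc]
  exact sq_integral_le_mul_integral_sq (by positivity) hφc

variable [FiniteDimensional ℝ E] [MeasurableSpace E] [BorelSpace E]

theorem stdGaussian_absolutelyContinuous : stdGaussian E ≪ (volume : Measure E) := by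
  rw [stdGaussian_eq_withDensity]
  exact withDensity_absolutelyContinuous _ _

theorem stdGaussian_ae_ne_zero (hE : 0 < Module.finrank ℝ E) : ∀ᵐ x ∂(stdGaussian E), x ≠ 0 := by
  have hnt : Nontrivial E := Module.nontrivial_of_finrank_pos (R := ℝ) hE
  exact stdGaussian_absolutelyContinuous.ae_le (Measure.ae_ne volume 0)

/-- Given `x ≠ 0`, the line through `x` is a null set when the dimension is at least two. -/
theorem ae_linearIndependent_pair_stdGaussian (hE : 2 ≤ Module.finrank ℝ E) :
    ∀ᵐ p ∂((stdGaussian E).prod (stdGaussian E)), LinearIndependent ℝ ![p.1, p.2] := by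
  have hms : MeasurableSet {p : E × E | LinearIndependent ℝ ![p.1, p.2]} := by
    have ho := isOpen_setOfPred_linearIndependent (𝕜 := ℝ) (E := E) (ι := Fin 2)
    have : Continuous fun p : E × E ↦ ![p.1, p.2] := by
      refine continuous_pi fun i ↦ ?_
      fin_cases i
      · exact continuous_fst
      · exact continuous_snd
    exact (ho.preimage this).measurableSet
  rw [Measure.ae_prod_iff_ae_ae hms]
  filter_upwards [stdGaussian_ae_ne_zero (by omega)] with x hx
  have h1 : ∀ᵐ y ∂(volume : Measure E), y ∉ (Submodule.span ℝ {x} : Submodule ℝ E) := by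
    have := Measure.addHaar_submodule (volume : Measure E) (Submodule.span ℝ {x}) (fun h ↦ by
      have h2 := finrank_span_singleton (K := ℝ) hx
      rw [h, finrank_top] at h2
      omega)
    rw [ae_iff]
    simpa using this
  filter_upwards [stdGaussian_absolutelyContinuous.ae_le h1] with y hy
  rw [LinearIndependent.pair_iff' hx]
  intro a ha
  exact hy (Submodule.mem_span_singleton.2 ⟨a, ha⟩)

/-- Gaussian Poincaré inequality, with the non-optimal constant `π² / 8`, for functions that are `C¹`
with bounded derivative away from the origin. For independent `X`, `Y` the variance is half of
`𝔼 (G Y - G X)²`, which is estimated by integrating along the arc from `X` to `Y`: by rotation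
invariance, every point of the arc and its velocity have the same joint law as `(X, Y)`. -/
theorem variance_stdGaussian_le {G : E → ℝ} (hE : 2 ≤ Module.finrank ℝ E)
    (hG : ∀ x ≠ 0, ContDiffAt ℝ 1 G x) {C : ℝ} (hC : ∀ x ≠ 0, ‖fderiv ℝ G x‖ ≤ C)
    (hG2 : MemLp G 2 (stdGaussian E)) :
    Var[G; stdGaussian E] ≤ Real.pi ^ 2 / 8 * ∫ x, ‖fderiv ℝ G x‖ ^ 2 ∂(stdGaussian E) := by
  set γ := stdGaussian E with hγ
  have hGm : Measurable G := by
    refine measurable_of_continuousOn_compl_singleton 0 fun x hx ↦ ?_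
    exact (hG x hx).continuousAt.continuousWithinAt
  have hDm : Measurable fun p : E × E ↦ fderiv ℝ G p.1 p.2 := by
    exact (ContinuousLinearMap.measurable_apply₂ (𝕜 := ℝ) (E := E) (F := ℝ)).comp
      (((measurable_fderiv ℝ G).comp measurable_fst).prodMk measurable_snd)
  have h0 : ∀ᵐ x ∂γ, x ≠ 0 := stdGaussian_ae_ne_zero (by omega)
  have hDint : Integrable (fun p : E × E ↦ fderiv ℝ G p.1 p.2 ^ 2) (γ.prod γ) := by
    have hb : Integrable (fun p : E × E ↦ C ^ 2 * ‖p.2‖ ^ 2) (γ.prod γ) :=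
      ((IsGaussian.memLp_two_id (μ := γ)).norm.integrable_sq.comp_snd γ).const_mul _
    refine hb.mono' (hDm.pow_const 2).aestronglyMeasurable ?_
    filter_upwards [Measure.quasiMeasurePreserving_fst.ae h0] with p hp
    rw [Real.norm_of_nonneg (sq_nonneg _), ← mul_pow, sq_le_sq, abs_mul, abs_norm]
    calc |fderiv ℝ G p.1 p.2| ≤ ‖fderiv ℝ G p.1‖ * ‖p.2‖ := (fderiv ℝ G p.1).le_opNorm _
      _ ≤ |C| * ‖p.2‖ := by gcongr; exact (hC _ hp).trans (le_abs_self C)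
  have hDval : ∫ p, fderiv ℝ G p.1 p.2 ^ 2 ∂(γ.prod γ) = ∫ x, ‖fderiv ℝ G x‖ ^ 2 ∂γ := by
    rw [integral_prod _ hDint]
    simp_rw [hγ, integral_clm_sq_stdGaussian]
  have hG1 : Integrable G γ := hG2.integrable one_le_two
  have hGsq : Integrable (fun x ↦ G x ^ 2) γ := hG2.integrable_sq
  have hexp : ∀ p : E × E, (G p.2 - G p.1) ^ 2 = G p.2 ^ 2 + G p.1 ^ 2 - 2 * (G p.1 * G p.2) :=
    fun p ↦ by ring
  have hFint : Integrable (fun p : E × E ↦ (G p.2 - G p.1) ^ 2) (γ.prod γ) := by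
    simp_rw [hexp]
    exact ((hGsq.comp_snd γ).add (hGsq.comp_fst γ)).sub ((hG1.mul_prod hG1).const_mul 2)
  have hFval : ∫ p, (G p.2 - G p.1) ^ 2 ∂(γ.prod γ) = 2 * Var[G; γ] := by
    simp_rw [hexp]
    rw [integral_sub ((hGsq.comp_snd γ).fun_add (hGsq.comp_fst γ)) ((hG1.mul_prod hG1).const_mul 2),
      integral_add (hGsq.comp_snd γ) (hGsq.comp_fst γ), integral_const_mul, integral_prod_mul,
      integral_fun_snd (fun x ↦ G x ^ 2), integral_fun_fst (fun x ↦ G x ^ 2),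
      variance_eq_sub hG2]
    simp
    ring
  have hrot : ∀ t : ℝ, MeasurePreserving (ContinuousLinearMap.rotation (E := E) t)
      (γ.prod γ) (γ.prod γ) := fun t ↦
    ⟨(ContinuousLinearMap.rotation t).continuous.measurable,
      IsGaussian.map_rotation_eq_self_of_forall_strongDual_eq_zero
        integral_strongDual_stdGaussian t⟩
  have hDm' : Measurable fun p : E × E ↦ ENNReal.ofReal (fderiv ℝ G p.1 p.2 ^ 2) :=
    (hDm.pow_const 2).ennreal_ofReal
  -- Lower integrals permit exchanging the integrals in `p` and `t` with no integrability condition.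
  have hle : ∫⁻ p, ENNReal.ofReal ((G p.2 - G p.1) ^ 2) ∂(γ.prod γ) ≤
      ENNReal.ofReal (Real.pi / 2) * (ENNReal.ofReal (Real.pi / 2) *
        ∫⁻ p, ENNReal.ofReal (fderiv ℝ G p.1 p.2 ^ 2) ∂(γ.prod γ)) := by
    have hmeas0 : Measurable fun q : (E × E) × ℝ ↦
        fderiv ℝ G (ContinuousLinearMap.rotation q.2 q.1).1
          (ContinuousLinearMap.rotation q.2 q.1).2 ^ 2 := by
      refine (hDm.pow_const 2).comp (g := fun p : E × E ↦ fderiv ℝ G p.1 p.2 ^ 2)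
        (f := fun q : (E × E) × ℝ ↦ ContinuousLinearMap.rotation q.2 q.1) ?_
      simp only [ContinuousLinearMap.rotation_apply]
      fun_prop
    have hmeas := hmeas0.ennreal_ofReal
    calc ∫⁻ p, ENNReal.ofReal ((G p.2 - G p.1) ^ 2) ∂(γ.prod γ)
        ≤ ∫⁻ p, (ENNReal.ofReal (Real.pi / 2) * ∫⁻ t in Ioc 0 (Real.pi / 2),
            ENNReal.ofReal (fderiv ℝ G (ContinuousLinearMap.rotation t p).1
              (ContinuousLinearMap.rotation t p).2 ^ 2)) ∂(γ.prod γ) := by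
          refine lintegral_mono_ae ?_
          filter_upwards [ae_linearIndependent_pair_stdGaussian hE] with p hp
          refine (ENNReal.ofReal_le_ofReal (sq_sub_le_integral_sq_fderiv_rotation hG hp)).trans ?_
          rw [ENNReal.ofReal_mul (by positivity),
            intervalIntegral.integral_of_le (by positivity)]
          gcongr
          rw [integral_eq_lintegral_of_nonneg_ae (ae_of_all _ fun _ ↦ sq_nonneg _)
            (hmeas0.comp measurable_prodMk_left).aestronglyMeasurable]
          exact ENNReal.ofReal_toReal_le
      _ = ENNReal.ofReal (Real.pi / 2) * ∫⁻ t in Ioc 0 (Real.pi / 2), ∫⁻ p,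
            ENNReal.ofReal (fderiv ℝ G (ContinuousLinearMap.rotation t p).1
              (ContinuousLinearMap.rotation t p).2 ^ 2) ∂(γ.prod γ) := by
          rw [lintegral_const_mul _ hmeas.lintegral_prod_right',
            lintegral_lintegral_swap hmeas.aemeasurable]
      _ = _ := by
          have : ∀ t : ℝ, ∫⁻ p, ENNReal.ofReal (fderiv ℝ G (ContinuousLinearMap.rotation t p).1
              (ContinuousLinearMap.rotation t p).2 ^ 2) ∂(γ.prod γ) =
              ∫⁻ p, ENNReal.ofReal (fderiv ℝ G p.1 p.2 ^ 2) ∂(γ.prod γ) := fun t ↦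
            (hrot t).lintegral_comp hDm'
          simp_rw [this]
          rw [setLIntegral_const, Real.volume_Ioc, sub_zero, mul_comm (∫⁻ _, _ ∂_)]
  rw [← ofReal_integral_eq_lintegral_ofReal hFint (ae_of_all _ fun _ ↦ sq_nonneg _),
    ← ofReal_integral_eq_lintegral_ofReal hDint (ae_of_all _ fun _ ↦ sq_nonneg _),
    ← ENNReal.ofReal_mul (by positivity), ← ENNReal.ofReal_mul (by positivity), hFval, hDval,
    ENNReal.ofReal_le_ofReal_iff (by positivity)] at hle
  linarith

end GaussianPoincare

/-! ### The homogeneous extension of a function on the sphere -/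

section HomogeneousExtension

variable {E : Type*} [NormedAddCommGroup E] [InnerProductSpace ℝ E]

/-- The extension `x ↦ ‖x‖ g(x / ‖x‖)`, homogeneous of degree one, of the restriction of `g` to the unit
sphere. Its value at the origin is `0`. -/
noncomputable def homogeneousExtension (g : E → ℝ) (x : E) : ℝ :=
  ‖x‖ * g (‖x‖⁻¹ • x)

theorem inv_norm_smul_mem_sphere {x : E} (hx : x ≠ 0) : ‖x‖⁻¹ • x ∈ sphere (0 : E) 1 := by
  simp [norm_smul, hx]

theorem contDiffAt_homogeneousExtension {g : E → ℝ} {x : E} (hx : x ≠ 0)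
    (hg : ContDiffAt ℝ 1 g (‖x‖⁻¹ • x)) : ContDiffAt ℝ 1 (homogeneousExtension g) x := by
  have hN : ContDiffAt ℝ 1 (fun y : E ↦ ‖y‖) x := contDiffAt_norm ℝ hx
  have hθ : ContDiffAt ℝ 1 (fun y : E ↦ ‖y‖⁻¹ • y) x :=
    (hN.inv (norm_ne_zero_iff.2 hx)).smul contDiffAt_id
  exact hN.mul (ContDiffAt.comp x (f := fun y : E ↦ ‖y‖⁻¹ • y) hg hθ)

theorem hasFDerivAt_norm_of_ne_zero {x : E} (hx : x ≠ 0) :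
    HasFDerivAt (fun y : E ↦ ‖y‖) (innerSL ℝ (‖x‖⁻¹ • x)) x := by
  have h := (hasStrictFDerivAt_norm_sq x).hasFDerivAt.sqrt (by simpa using hx)
  simp only [Real.sqrt_sq (norm_nonneg _)] at h
  convert h using 1
  ext v
  simp
  ring

theorem fderiv_homogeneousExtension_apply {g : E → ℝ} {x : E} (hx : x ≠ 0)
    (hg : DifferentiableAt ℝ g (‖x‖⁻¹ • x)) (v : E) :
    fderiv ℝ (homogeneousExtension g) x v =
      inner ℝ (‖x‖⁻¹ • x) v * g (‖x‖⁻¹ • x) +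
        fderiv ℝ g (‖x‖⁻¹ • x) (v - inner ℝ (‖x‖⁻¹ • x) v • ‖x‖⁻¹ • x) := by
  have hx' : ‖x‖ ≠ 0 := norm_ne_zero_iff.2 hx
  have hN := hasFDerivAt_norm_of_ne_zero hx
  have hI := (hasDerivAt_inv hx').comp_hasFDerivAt x hN
  have hθ := hI.smul (hasFDerivAt_id x)
  have hG := hN.mul (HasFDerivAt.comp x (f := fun y : E ↦ ‖y‖⁻¹ • y) hg.hasFDerivAt hθ)
  have : fderiv ℝ (homogeneousExtension g) x = _ := hG.fderiv
  rw [this]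
  simp only [Function.comp_apply, id_eq, add_apply,
    smul_apply, ContinuousLinearMap.comp_apply, smul_eq_mul,
    ContinuousLinearMap.smulRight_apply, innerSL_apply_apply, real_inner_smul_left, map_add, map_sub, map_smul,
    ContinuousLinearMap.coe_id']
  field_simp
  ring

/-- The radial derivative of the extension is `g`, and its tangential derivative is that of `g`. The
normal part of the derivative of `g` does not contribute, so this is only an inequality. -/
theorem norm_fderiv_homogeneousExtension_sq_le {g : E → ℝ} {x : E} (hx : x ≠ 0)
    (hg : DifferentiableAt ℝ g (‖x‖⁻¹ • x)) :
    ‖fderiv ℝ (homogeneousExtension g) x‖ ^ 2 ≤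
      g (‖x‖⁻¹ • x) ^ 2 + ‖fderiv ℝ g (‖x‖⁻¹ • x)‖ ^ 2 := by
  set θ := ‖x‖⁻¹ • x with hθ
  have hθ1 : ‖θ‖ = 1 := by simpa using inv_norm_smul_mem_sphere hx
  set L := fderiv ℝ g θ
  suffices ‖fderiv ℝ (homogeneousExtension g) x‖ ≤ √(g θ ^ 2 + ‖L‖ ^ 2) by
    rw [← Real.sq_sqrt (show 0 ≤ g θ ^ 2 + ‖L‖ ^ 2 by positivity)]
    gcongr
  refine ContinuousLinearMap.opNorm_le_bound _ (Real.sqrt_nonneg _) fun v ↦ ?_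
  rw [fderiv_homogeneousExtension_apply hx hg, Real.norm_eq_abs]
  refine Real.abs_le_sqrt (y := (g θ ^ 2 + ‖L‖ ^ 2) * ‖v‖ ^ 2) ?_ |>.trans_eq ?_
  swap
  · rw [Real.sqrt_mul (by positivity), Real.sqrt_sq (norm_nonneg _)]
  rw [← hθ]
  set s := inner ℝ θ v
  -- Decompose `v` into its radial part `s • θ` and its tangential part.
  have hpyth : ‖v‖ ^ 2 = s ^ 2 + ‖v - s • θ‖ ^ 2 := by
    rw [norm_sub_sq_real, norm_smul, hθ1, inner_smul_right, real_inner_comm, Real.norm_eq_abs,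
      mul_one, sq_abs]
    ring
  have hL : |L (v - s • θ)| ≤ ‖L‖ * ‖v - s • θ‖ := L.le_opNorm _
  have hL2 : L (v - s • θ) ^ 2 ≤ ‖L‖ ^ 2 * ‖v - s • θ‖ ^ 2 := by
    rw [← mul_pow, ← sq_abs]
    gcongr
  have habs : |s * g θ + L (v - s • θ)| ≤ |g θ| * |s| + ‖L‖ * ‖v - s • θ‖ := by
    refine (abs_add_le _ _).trans ?_
    rw [abs_mul, mul_comm |s|]
    gcongr
  calc (s * g θ + L (v - s • θ)) ^ 2 = |s * g θ + L (v - s • θ)| ^ 2 := (sq_abs _).symm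
    _ ≤ (|g θ| * |s| + ‖L‖ * ‖v - s • θ‖) ^ 2 := by gcongr
    _ ≤ (|g θ| ^ 2 + ‖L‖ ^ 2) * (|s| ^ 2 + ‖v - s • θ‖ ^ 2) := by
        nlinarith [sq_nonneg (|g θ| * ‖v - s • θ‖ - ‖L‖ * |s|)]
    _ = _ := by rw [hpyth, sq_abs, sq_abs]

end HomogeneousExtension

/-! ### The Poincaré inequality on the sphere -/

section SpherePoincare

variable {n : ℕ}

theorem integral_sphereUniform (φ : EuclideanSpace ℝ (Fin n) → ℝ) :
    ∫ θ, φ θ ∂(sphereUniform n) =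
      ((volume : Measure (EuclideanSpace ℝ (Fin n))).toSphere.real univ)⁻¹ *
        ∫ θ : sphere (0 : EuclideanSpace ℝ (Fin n)) 1, φ θ
          ∂(volume : Measure (EuclideanSpace ℝ (Fin n))).toSphere := by
  rw [sphereUniform, integral_smul_measure, smul_eq_mul, ENNReal.toReal_inv, measureReal_def]

theorem isProbabilityMeasure_sphereUniform (hn : 2 ≤ n) :
    IsProbabilityMeasure (sphereUniform n) := by
  have : Nontrivial (EuclideanSpace ℝ (Fin n)) :=
    Module.nontrivial_of_finrank_pos (R := ℝ) (by simp; omega)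
  constructor
  rw [sphereUniform, Measure.smul_apply, smul_eq_mul]
  exact ENNReal.inv_mul_cancel (Measure.measure_univ_ne_zero.2 (Measure.toSphere_ne_zero _))
    (measure_ne_top _ _)

theorem integrable_sphereUniform (hn : 2 ≤ n) {φ : EuclideanSpace ℝ (Fin n) → ℝ}
    (hφ : ContinuousOn φ (sphere 0 1)) :
    Integrable (fun θ : sphere (0 : EuclideanSpace ℝ (Fin n)) 1 ↦ φ θ) (sphereUniform n) := by
  have := isProbabilityMeasure_sphereUniform hn
  exact (continuousOn_iff_continuous_domRestrict.1 hφ).integrable_of_hasCompactSupport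
    (HasCompactSupport.of_compactSpace _)

/-- Poincaré inequality on the sphere, with twice the optimal constant and the full Euclidean derivative
in place of the spherical gradient. -/
theorem sphere_poincare (hn : 2 ≤ n) {g : EuclideanSpace ℝ (Fin n) → ℝ}
    (hg : ∀ θ ∈ sphere (0 : EuclideanSpace ℝ (Fin n)) 1, ContDiffAt ℝ 1 g θ)
    (hmean : ∫ θ, g θ ∂(sphereUniform n) = 0) :
    ((n : ℝ) - 1) * ∫ θ, g θ ^ 2 ∂(sphereUniform n) ≤
      2 * ∫ θ, ‖fderiv ℝ g θ‖ ^ 2 ∂(sphereUniform n) := by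
  have hdim : 2 ≤ Module.finrank ℝ (EuclideanSpace ℝ (Fin n)) := by simpa using hn
  have hnt : Nontrivial (EuclideanSpace ℝ (Fin n)) :=
    Module.nontrivial_of_finrank_pos (R := ℝ) (by omega)
  have hprob := isProbabilityMeasure_sphereUniform hn
  set γ := stdGaussian (EuclideanSpace ℝ (Fin n)) with hγ
  have hgc : ContinuousOn g (sphere 0 1) := fun θ hθ ↦ (hg θ hθ).continuousAt.continuousWithinAt
  have hDc : ContinuousOn (fderiv ℝ g) (sphere 0 1) := fun θ hθ ↦
    ((hg θ hθ).continuousAt_fderiv one_ne_zero).continuousWithinAt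
  obtain ⟨M, hM⟩ := (isCompact_sphere (0 : EuclideanSpace ℝ (Fin n)) 1).exists_bound_of_continuousOn
    hgc
  set ψ : EuclideanSpace ℝ (Fin n) → ℝ := fun θ ↦ g θ ^ 2 + ‖fderiv ℝ g θ‖ ^ 2 with hψ
  have hψc : ContinuousOn ψ (sphere 0 1) := (hgc.pow 2).add (hDc.norm.pow 2)
  obtain ⟨C, hC⟩ := (isCompact_sphere (0 : EuclideanSpace ℝ (Fin n)) 1).exists_bound_of_continuousOn
    hψc
  set G := homogeneousExtension g with hG
  have hGd : ∀ x ≠ 0, ContDiffAt ℝ 1 G x := fun x hx ↦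
    contDiffAt_homogeneousExtension hx (hg _ (inv_norm_smul_mem_sphere hx))
  have hGψ : ∀ x ≠ 0, ‖fderiv ℝ G x‖ ^ 2 ≤ ψ (‖x‖⁻¹ • x) := fun x hx ↦
    norm_fderiv_homogeneousExtension_sq_le hx
      ((hg _ (inv_norm_smul_mem_sphere hx)).differentiableAt one_ne_zero)
  have hGC : ∀ x ≠ 0, ‖fderiv ℝ G x‖ ≤ √C := fun x hx ↦ Real.le_sqrt_of_sq_le <|
    (hGψ x hx).trans <| (le_abs_self _).trans (hC _ (inv_norm_smul_mem_sphere hx))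
  have hGm : Measurable G := measurable_of_continuousOn_compl_singleton 0 fun x hx ↦
    (hGd x hx).continuousAt.continuousWithinAt
  have hγ0 : ∀ᵐ x ∂γ, x ≠ 0 := stdGaussian_ae_ne_zero (by omega)
  have hGL : MemLp G 2 γ := by
    refine (IsGaussian.memLp_two_id (μ := γ)).of_le_mul (c := M) hGm.aestronglyMeasurable ?_
    filter_upwards [hγ0] with x hx
    rw [hG, homogeneousExtension, norm_mul, norm_norm, mul_comm, id]
    gcongr
    exact hM _ (inv_norm_smul_mem_sphere hx)
  have hGmean : ∫ x, G x ∂γ = 0 := by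
    have := integral_stdGaussian_norm_mul_direction (k := fun r ↦ r) (φ := g)
    rw [← integral_sphereUniform g, hmean, mul_zero] at this
    exact this
  have hGsq : ∫ x, G x ^ 2 ∂γ = n * ∫ θ, g θ ^ 2 ∂(sphereUniform n) := by
    have := integral_stdGaussian_norm_mul_direction (k := fun r ↦ r ^ 2) (φ := fun x ↦ g x ^ 2)
    rw [← integral_sphereUniform (fun θ ↦ g θ ^ 2), integral_stdGaussian_norm_sq,
      finrank_euclideanSpace_fin] at this
    rw [← this]
    simp_rw [hG, homogeneousExtension, mul_pow]
    rfl
  have hvar := variance_stdGaussian_le hdim hGd hGC hGL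
  rw [variance_of_integral_eq_zero hGm.aemeasurable hGmean, ← hγ, hGsq] at hvar
  have hψint : Integrable (fun x ↦ ψ (‖x‖⁻¹ • x)) γ := by
    have hm : Measurable fun x : EuclideanSpace ℝ (Fin n) ↦ ψ (‖x‖⁻¹ • x) := by
      refine measurable_of_continuousOn_compl_singleton 0 ?_
      refine hψc.comp (f := fun x ↦ ‖x‖⁻¹ • x) ?_ fun x hx ↦ inv_norm_smul_mem_sphere hx
      exact (continuous_norm.continuousOn.inv₀ fun x hx ↦ norm_ne_zero_iff.2 hx).smul
        continuousOn_id
    refine (integrable_const C).mono' hm.aestronglyMeasurable ?_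
    filter_upwards [hγ0] with x hx using hC _ (inv_norm_smul_mem_sphere hx)
  have hDle : ∫ x, ‖fderiv ℝ G x‖ ^ 2 ∂γ ≤
      ∫ θ, g θ ^ 2 ∂(sphereUniform n) + ∫ θ, ‖fderiv ℝ g θ‖ ^ 2 ∂(sphereUniform n) := by
    have h1 : ∫ x, ‖fderiv ℝ G x‖ ^ 2 ∂γ ≤ ∫ x, ψ (‖x‖⁻¹ • x) ∂γ := by
      refine integral_mono_of_nonneg (ae_of_all _ fun _ ↦ sq_nonneg _) hψint ?_
      filter_upwards [hγ0] with x hx using hGψ x hx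
    have h2 := integral_stdGaussian_norm_mul_direction (k := fun _ ↦ 1) (φ := ψ)
    rw [← integral_sphereUniform ψ] at h2
    simp only [one_mul, integral_const, probReal_univ, smul_eq_mul] at h2
    rw [← hγ] at h2
    rw [h2] at h1
    refine h1.trans_eq (integral_add ?_ ?_)
    · exact integrable_sphereUniform hn (hgc.pow 2)
    · exact integrable_sphereUniform hn (hDc.norm.pow 2)
  have hn' : (2 : ℝ) ≤ n := by exact_mod_cast hn
  have hA : 0 ≤ ∫ θ, g θ ^ 2 ∂(sphereUniform n) := integral_nonneg fun _ ↦ sq_nonneg _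
  have hB : 0 ≤ ∫ θ, ‖fderiv ℝ g θ‖ ^ 2 ∂(sphereUniform n) := integral_nonneg fun _ ↦ sq_nonneg _
  have hpi : Real.pi ^ 2 / 8 ≤ 5 / 4 := by
    have := Real.pi_lt_d2
    have := Real.pi_pos
    nlinarith
  generalize ∫ θ, g θ ^ 2 ∂(sphereUniform n) = A at *
  generalize ∫ θ, ‖fderiv ℝ g θ‖ ^ 2 ∂(sphereUniform n) = B at *
  have h3 : (n : ℝ) * A ≤ 5 / 4 * (A + B) :=
    hvar.trans (by gcongr)
  nlinarith

end SpherePoincare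

/-! ### The second order inequality -/

section SecondOrder

variable {n : ℕ}

/-- The Poincaré inequality `sphere_poincare` without the assumption that `g` has mean zero. -/
theorem sphere_poincare_centered (hn : 2 ≤ n) {g : EuclideanSpace ℝ (Fin n) → ℝ}
    (hg : ∀ θ ∈ sphere (0 : EuclideanSpace ℝ (Fin n)) 1, ContDiffAt ℝ 1 g θ) :
    ((n : ℝ) - 1) * ∫ θ, (g θ - ∫ η, g η ∂(sphereUniform n)) ^ 2 ∂(sphereUniform n) ≤
      2 * ∫ θ, ‖fderiv ℝ g θ‖ ^ 2 ∂(sphereUniform n) := by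
  have := isProbabilityMeasure_sphereUniform hn
  set m := ∫ η, g η ∂(sphereUniform n) with hm
  have h := sphere_poincare hn (g := fun x ↦ g x - m) (fun θ hθ ↦ (hg θ hθ).sub contDiffAt_const)
    (by
      rw [integral_sub (integrable_sphereUniform hn fun θ hθ ↦
        (hg θ hθ).continuousAt.continuousWithinAt) (integrable_const _)]
      simp [hm])
  simpa only [fderiv_sub_const] using h

theorem contDiffAt_partialDeriv {f : EuclideanSpace ℝ (Fin n) → ℝ} {x : EuclideanSpace ℝ (Fin n)}
    (hf : ContDiffAt ℝ 2 f x) (i : Fin n) : ContDiffAt ℝ 1 (partialDeriv i f) x :=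
  (hf.fderiv_right (m := 1) (by norm_num)).clm_apply contDiffAt_const

theorem norm_strongDual_sq_eq_sum (L : StrongDual ℝ (EuclideanSpace ℝ (Fin n))) :
    ‖L‖ ^ 2 = ∑ i, L (EuclideanSpace.single i 1) ^ 2 := by
  simpa using (EuclideanSpace.basisFun (Fin n) ℝ).norm_dual L

theorem frobenius_norm_sq (A : Matrix (Fin n) (Fin n) ℝ) : ‖A‖ ^ 2 = ∑ i, ∑ j, A i j ^ 2 := by
  rw [Matrix.frobenius_norm_def, ← Real.sqrt_eq_rpow, Real.sq_sqrt (by positivity)]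
  simp

/-- The derivative of the vector field `∇f - a x` is `f'' - a I`. -/
theorem sum_norm_fderiv_partialDeriv_sq {f : EuclideanSpace ℝ (Fin n) → ℝ}
    {x : EuclideanSpace ℝ (Fin n)} (hf : ContDiffAt ℝ 2 f x) (a : ℝ) :
    ∑ i, ‖fderiv ℝ (fun y ↦ partialDeriv i f y - a * y i) x‖ ^ 2 =
      ‖hessianMatrix f x - a • (1 : Matrix (Fin n) (Fin n) ℝ)‖ ^ 2 := by
  rw [frobenius_norm_sq, Finset.sum_comm]
  refine Finset.sum_congr rfl fun i _ ↦ ?_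
  rw [norm_strongDual_sq_eq_sum]
  refine Finset.sum_congr rfl fun j _ ↦ ?_
  have h1 := ((contDiffAt_partialDeriv hf i).differentiableAt one_ne_zero).hasFDerivAt
  have h2 : HasFDerivAt (fun y : EuclideanSpace ℝ (Fin n) ↦ y i)
      (EuclideanSpace.proj i : EuclideanSpace ℝ (Fin n) →L[ℝ] ℝ) x :=
    (EuclideanSpace.proj i : EuclideanSpace ℝ (Fin n) →L[ℝ] ℝ).hasFDerivAt
  rw [(h1.fun_sub (h2.const_mul a)).fderiv]
  simp [hessianMatrix, partialDeriv, Matrix.one_apply, eq_comm]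

/-- The gradient of `f - a ‖x‖² / 2 - ⟨m, x⟩` is `∇f - a x - m`. -/
theorem norm_fderiv_sub_quadratic_sq {f : EuclideanSpace ℝ (Fin n) → ℝ}
    {x : EuclideanSpace ℝ (Fin n)} (hf : DifferentiableAt ℝ f x) (a : ℝ)
    (m : EuclideanSpace ℝ (Fin n)) :
    ‖fderiv ℝ (fun y ↦ f y - a / 2 * ‖y‖ ^ 2 - inner ℝ m y) x‖ ^ 2 =
      ∑ i, (partialDeriv i f x - a * x i - m i) ^ 2 := by
  rw [norm_strongDual_sq_eq_sum]
  refine Finset.sum_congr rfl fun i _ ↦ ?_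
  have h2 := (hasStrictFDerivAt_norm_sq x).hasFDerivAt.const_mul (a / 2)
  have h3 : HasFDerivAt (fun y : EuclideanSpace ℝ (Fin n) ↦ inner ℝ m y) (innerSL ℝ m) x :=
    (innerSL ℝ m).hasFDerivAt
  rw [((hf.hasFDerivAt.fun_sub h2).fun_sub h3).fderiv]
  simp [partialDeriv, EuclideanSpace.inner_single_right]
  ring

theorem integral_sq_le_integral_sub_affine_sq (hn : 2 ≤ n) {f : EuclideanSpace ℝ (Fin n) → ℝ}
    (hf : ContinuousOn f (sphere 0 1)) (horth : OrthogonalToAffine f)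
    (l : EuclideanSpace ℝ (Fin n) →ᵃ[ℝ] ℝ) :
    ∫ θ, f θ ^ 2 ∂(sphereUniform n) ≤ ∫ θ, (f θ - l θ) ^ 2 ∂(sphereUniform n) := by
  have hl : ContinuousOn l (sphere 0 1) := l.continuous_of_finiteDimensional.continuousOn
  have h2 : ∫ θ, (f θ - l θ) ^ 2 ∂(sphereUniform n) =
      ∫ θ, f θ ^ 2 ∂(sphereUniform n) + ∫ θ, l θ ^ 2 ∂(sphereUniform n) := by
    have : ∀ θ : sphere (0 : EuclideanSpace ℝ (Fin n)) 1,
        (f θ - l θ) ^ 2 = f θ ^ 2 + l θ ^ 2 - 2 * (f θ * l θ) := fun θ ↦ by ring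
    simp_rw [this]
    rw [integral_sub, integral_add, integral_const_mul, horth l]
    · ring
    · exact integrable_sphereUniform hn (hf.pow 2)
    · exact integrable_sphereUniform hn (hl.pow 2)
    · exact integrable_sphereUniform hn (φ := fun θ ↦ f θ ^ 2 + l θ ^ 2)
        ((hf.pow 2).add (hl.pow 2))
    · exact integrable_sphereUniform hn (φ := fun θ ↦ 2 * (f θ * l θ))
        ((hf.mul hl).const_mul 2)
  rw [h2]
  exact le_add_of_nonneg_right (integral_nonneg fun _ ↦ sq_nonneg _)

end SecondOrder

theorem corollary6p2 (n : ℕ) (hn : 2 ≤ n) (G : Set (EuclideanSpace ℝ (Fin n))) (hG : IsOpen G)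
    (hSG : Metric.sphere (0 : EuclideanSpace ℝ (Fin n)) 1 ⊆ G)
    (f : EuclideanSpace ℝ (Fin n) → ℝ) (hf : ContDiffOn ℝ 2 f G)
    (horth : OrthogonalToAffine f) (a : ℝ) :
    ∫ θ, f θ ^ 2 ∂(sphereUniform n) ≤
      5 / ((n : ℝ) - 1) ^ 2 *
        ∫ θ, ‖hessianMatrix f θ - a • (1 : Matrix (Fin n) (Fin n) ℝ)‖ ^ 2 ∂(sphereUniform n) := by
  have hfat : ∀ θ ∈ sphere (0 : EuclideanSpace ℝ (Fin n)) 1, ContDiffAt ℝ 2 f θ := fun θ hθ ↦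
    hf.contDiffAt (hG.mem_nhds (hSG hθ))
  set v : Fin n → EuclideanSpace ℝ (Fin n) → ℝ := fun i y ↦ partialDeriv i f y - a * y i with hv
  have hv1 : ∀ i, ∀ θ ∈ sphere (0 : EuclideanSpace ℝ (Fin n)) 1, ContDiffAt ℝ 1 (v i) θ :=
    fun i θ hθ ↦ (contDiffAt_partialDeriv (hfat θ hθ) i).sub
      (contDiffAt_const.mul
        (EuclideanSpace.proj i : EuclideanSpace ℝ (Fin n) →L[ℝ] ℝ).contDiff.contDiffAt)
  -- The mean of the vector field `v`; subtracting `⟨m, x⟩` from `f` centres the gradient.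
  set m : EuclideanSpace ℝ (Fin n) :=
    WithLp.toLp 2 fun i ↦ ∫ θ, v i θ ∂(sphereUniform n) with hm
  set h : EuclideanSpace ℝ (Fin n) → ℝ := fun y ↦ f y - a / 2 * ‖y‖ ^ 2 - inner ℝ m y with hh
  set c := ∫ θ, h θ ∂(sphereUniform n) with hc
  have hh1 : ∀ θ ∈ sphere (0 : EuclideanSpace ℝ (Fin n)) 1, ContDiffAt ℝ 1 h θ := fun θ hθ ↦
    (((hfat θ hθ).of_le one_le_two).sub (contDiffAt_const.mul (contDiff_norm_sq ℝ).contDiffAt)).sub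
      (innerSL ℝ m).contDiff.contDiffAt
  have hgrad : ((n : ℝ) - 1) * ∫ θ, ‖fderiv ℝ h θ‖ ^ 2 ∂(sphereUniform n) ≤
      2 * ∫ θ, ‖hessianMatrix f θ - a • (1 : Matrix (Fin n) (Fin n) ℝ)‖ ^ 2
        ∂(sphereUniform n) := by
    have hL : ∀ θ : sphere (0 : EuclideanSpace ℝ (Fin n)) 1,
        ‖fderiv ℝ h θ‖ ^ 2 = ∑ i, (v i θ - m i) ^ 2 := fun θ ↦
      norm_fderiv_sub_quadratic_sq ((hfat θ θ.2).differentiableAt two_ne_zero) a m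
    have hR : ∀ θ : sphere (0 : EuclideanSpace ℝ (Fin n)) 1,
        ‖hessianMatrix f θ - a • (1 : Matrix (Fin n) (Fin n) ℝ)‖ ^ 2 =
          ∑ i, ‖fderiv ℝ (v i) θ‖ ^ 2 := fun θ ↦
      (sum_norm_fderiv_partialDeriv_sq (hfat θ θ.2) a).symm
    simp_rw [hL, hR]
    rw [integral_finsetSum, integral_finsetSum, Finset.mul_sum, Finset.mul_sum]
    · exact Finset.sum_le_sum fun i _ ↦ sphere_poincare_centered hn (hv1 i)
    · intro i _
      exact integrable_sphereUniform hn (φ := fun θ ↦ ‖fderiv ℝ (v i) θ‖ ^ 2) fun θ hθ ↦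
        (((hv1 i θ hθ).continuousAt_fderiv one_ne_zero).norm.pow 2).continuousWithinAt
    · intro i _
      exact integrable_sphereUniform hn (φ := fun θ ↦ (v i θ - m i) ^ 2) fun θ hθ ↦
        (((hv1 i θ hθ).continuousAt.sub continuousAt_const).pow 2).continuousWithinAt
  -- On the sphere `a ‖x‖² / 2` is the constant `a / 2`, so `h - c` differs from `f` by an affine function.
  set l : EuclideanSpace ℝ (Fin n) →ᵃ[ℝ] ℝ :=
    AffineMap.const ℝ _ (a / 2 + c) + (innerSL ℝ m).toLinearMap.toAffineMap with hl
  have hhl : ∀ θ : sphere (0 : EuclideanSpace ℝ (Fin n)) 1, h θ - c = f θ - l θ := fun θ ↦ by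
    have hθ : ‖(θ : EuclideanSpace ℝ (Fin n))‖ = 1 := by simp
    simp [hh, hl, hθ]
    ring
  have hmain := sphere_poincare_centered hn hh1
  simp_rw [← hc, hhl] at hmain
  have hfl := integral_sq_le_integral_sub_affine_sq hn
    (fun θ hθ ↦ (hfat θ hθ).continuousAt.continuousWithinAt) horth l
  have hn1 : 0 < (n : ℝ) - 1 := by
    have : (2 : ℝ) ≤ n := by exact_mod_cast hn
    linarith
  have hH : 0 ≤ ∫ θ, ‖hessianMatrix f θ - a • (1 : Matrix (Fin n) (Fin n) ℝ)‖ ^ 2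
      ∂(sphereUniform n) := integral_nonneg fun _ ↦ sq_nonneg _
  rw [div_mul_eq_mul_div, le_div_iff₀ (by positivity)]
  generalize ∫ θ, ‖hessianMatrix f θ - a • (1 : Matrix (Fin n) (Fin n) ℝ)‖ ^ 2
    ∂(sphereUniform n) = H at *
  generalize ∫ θ, ‖fderiv ℝ h θ‖ ^ 2 ∂(sphereUniform n) = B at *
  calc (∫ θ, f θ ^ 2 ∂(sphereUniform n)) * ((n : ℝ) - 1) ^ 2
      ≤ (∫ θ, (f θ - l θ) ^ 2 ∂(sphereUniform n)) * ((n : ℝ) - 1) ^ 2 := by gcongr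
    _ = ((n : ℝ) - 1) * (((n : ℝ) - 1) * ∫ θ, (f θ - l θ) ^ 2 ∂(sphereUniform n)) := by ring
    _ ≤ ((n : ℝ) - 1) * (2 * B) := by gcongr
    _ = 2 * (((n : ℝ) - 1) * B) := by ring
    _ ≤ 2 * (2 * H) := by gcongr
    _ ≤ 5 * H := by linarith
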